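/- **Setting.** Let $\mathcal H$ be a class of (measurable) functions $X\to\{0,1\}$ with VC-dimension $d\in\mathbb N\cup\{\infty\}$. For a target $f\in\mathcal H$ let $D^+$ and $D^-$ be probability distributions on the positive and on the negative examples of $f$. The oracles $\mathrm{Pos}^\lambda$, $\mathrm{Neg}^\lambda$ with outlier rate $\lambda$ return, independently at each call, with probability $1-\lambda$ an example drawn from $D^+$ (resp. $D^-$), and with probability $\lambda$ an arbitrary example chosen by an adversary who knows everything that has happened so far. A fixed finite number of examples is obtained from the oracles and is distributed in some way over two machines $M_1,M_2$. In a *$t$-round two-machine protocol* with public randomness the machines send $t$ messages in turn (either machine may start), the $i$-th message having $\ell_i$ bits and depending on the public coins, the sender's examples and the earlier messages; the recipient of the last message announces a hypothesis $h\in\mathcal H$. Its cost is $\ell_1+\dots+\ell_t$. The protocol *learns $\mathcal H$ to error $\epsilon$ with failure probability $\delta$* if for every target $f\in\mathcal H$, all $D^+,D^-$, every adversary and every distribution of the examples over the two machines, with probability at least $1-\delta$ the errors $D^+(h=0)$ and $D^-(h=1)$ are both less than $\epsilon$. Let $R^{M_1\leftrightarrow M_2}_{\epsilon}(\mathcal H)$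 be the least cost of a $t$-round protocol that does so ($\infty$ if there is none). **Theorem.** For all $\epsilon_0<\tfrac12$ and $0<\delta<1$ there are a constant $c>0$ and a $d_0\in\mathbb N$, depending only on $\epsilon_0$ and $\delta$, with $d_0\le 2$ if $\delta<\tfrac12$, such that for every class $\mathcal H$ with VC-dimension $d\ge d_0$, every error rate $\epsilon\le\epsilon_0$, every outlier rate $0\le\lambda<\epsilon$ and every $t\ge1$, $$R^{M_1\leftrightarrow M_2}_{\epsilon}(\mathcal H)\;\ge\; c\,\frac{1-\epsilon}{1-\lambda}\cdot\frac{d}{t^2}.$$ -/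

import Mathlib

open MeasureTheory
open scoped ENNReal

namespace RobustLearning

/-! ### VC-dimension -/

/-- The class `H` shatters the finite set `S`: every labelling of `S` is realised by a member
of `H`. -/
def Shatters {X : Type*} (H : Set (X → Bool)) (S : Finset X) : Prop :=
  ∀ g : X → Bool, ∃ h ∈ H, ∀ x ∈ S, h x = g x

/-- The VC-dimension of `H`: the supremum (possibly `⊤`) of the sizes of the finite sets that
`H` shatters. -/
noncomputable def vcDim {X : Type*} (H : Set (X → Bool)) : ℕ∞ :=
  ⨆ S : Finset X, ⨆ _ : Shatters H S, (S.card : ℕ∞)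

/-! ### The noisy oracles -/

/-- The law of the corruption flag of one oracle call: `true` (the call is corrupted) with
probability `lam`, and `false` with probability `1 - lam`. -/
noncomputable def flagLaw (lam : ℝ) : Measure Bool :=
  ENNReal.ofReal (1 - lam) • Measure.dirac false + ENNReal.ofReal lam • Measure.dirac true

/-- The law of the latent data of `m` independent oracle calls. Call `i` goes to the positive
oracle if `oracle i = true` and to the negative one if `oracle i = false`; its latent data are a
corruption flag and, independently of it, a clean example from the target distribution
`D (oracle i)`. -/
noncomputable def callLaw {X : Type*} [MeasurableSpace X] (lam : ℝ) (D : Bool → Measure X)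
    {m : ℕ} (oracle : Fin m → Bool) : Measure (Fin m → Bool × X) :=
  Measure.pi fun i => (flagLaw lam).prod (D (oracle i))

/-- A malicious adversary for `m` oracle calls. If call `i` is corrupted, it replaces the answer by
an example of its choice, which may depend on everything that has happened up to call `i`. -/
structure Adversary (X : Type*) [MeasurableSpace X] (m : ℕ) where
  /-- the example substituted in call `i`, given the latent data of the calls up to `i` -/
  choose : (i : Fin m) → (Set.Iic i → Bool × X) → X
  measurable_choose : ∀ i, Measurable (choose i)

/-- The examples that the noisy oracles return: the clean example where the flag is `false`, the
example chosen by the adversary where it is `true`. -/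
def Adversary.sample {X : Type*} [MeasurableSpace X] {m : ℕ} (A : Adversary X m)
    (z : Fin m → Bool × X) (i : Fin m) : X :=
  if (z i).1 then A.choose i (fun j => z j) else (z i).2

/-! ### Two-machine protocols -/

/-- The two machines. -/
inductive Machine
  | one
  | two
  deriving DecidableEq

/-- The other machine. -/
def Machine.other : Machine → Machine
  | .one => .two
  | .two => .one

/-- The part of the sample `x` that machine `M` holds, if example `i` is stored on machine
`place i`. -/
def localData {X : Type*} {m : ℕ} (place : Fin m → Machine) (x : Fin m → X) (M : Machine) :
    Fin m → Option X :=
  fun i => if place i = M then some (x i) else none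

/-- A public-coin two-machine protocol for learning with hypotheses from `H`. The number of rounds
is not part of the data: a `t`-round protocol uses the messages number `0, …, t - 1`. -/
structure Protocol {X : Type*} (H : Set (X → Bool)) where
  /-- number of oracle calls, that is, of training examples -/
  m : ℕ
  /-- which oracle (`true` positive, `false` negative) call `i` goes to -/
  oracle : Fin m → Bool
  /-- the public coins -/
  Coins : Type
  [measurableSpace : MeasurableSpace Coins]
  coinLaw : Measure Coins
  [isProbabilityMeasure : IsProbabilityMeasure coinLaw]
  /-- the machine that sends the first message -/
  first : Machine
  /-- the number of bits of message `i` -/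
  len : ℕ → ℕ
  /-- message `i`, computed by its sender from the public coins, the sender's part of the sample
  and the bits of the earlier messages -/
  msg : (i : ℕ) → Coins → (Fin m → Option X) → List Bool → (Fin (len i) → Bool)
  /-- the hypothesis announced, computed by the announcing machine from the public coins, its part
  of the sample and all the bits exchanged -/
  announce : Coins → (Fin m → Option X) → List Bool → H

namespace Protocol

attribute [instance] Protocol.measurableSpace Protocol.isProbabilityMeasure

variable {X : Type*} {H : Set (X → Bool)}

/-- The machine that sends message `i`; the machines speak in turn. -/
def speaker (P : Protocol H) : ℕ → Machine
  | 0 => P.first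
  | i + 1 => (P.speaker i).other

/-- The bits exchanged in the first `i` rounds, if machine `M` holds the data `v M`. -/
def transcript (P : Protocol H) (c : P.Coins) (v : Machine → Fin P.m → Option X) : ℕ → List Bool
  | 0 => []
  | i + 1 => P.transcript c v i ++
      List.ofFn (P.msg i c (v (P.speaker i)) (P.transcript c v i))

/-- The hypothesis learned in `t` rounds. It is announced by the recipient of the last message,
which is the machine whose turn it would be next. -/
def output (P : Protocol H) (t : ℕ) (c : P.Coins) (v : Machine → Fin P.m → Option X) : X → Bool :=
  P.announce c (v (P.speaker t)) (P.transcript c v t)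

/-- The number of bits exchanged in `t` rounds. -/
def cost (P : Protocol H) (t : ℕ) : ℕ := ∑ i ∈ Finset.range t, P.len i

/-- Robust PAC learning of `H` in `t` rounds, with error less than `ε`, failure probability at most
`δ` and outlier rate `lam`: whatever the target `f` in `H`, the target distributions `D true` and
`D false` on its positive and negative examples, the adversary, and the way in which the training
examples are distributed over the two machines, with probability at least `1 - δ` over public coins
and oracle calls, both the error on positive examples and the error on negative examples of the
learned hypothesis are less than `ε`.

Failure is measured by the outer measure of the set of bad outcomes, so a protocol whose messages
are not measurable gains nothing. -/
def Learns [MeasurableSpace X] (P : Protocol H) (t : ℕ) (ε δ lam : ℝ) : Prop :=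
  ∀ f ∈ H, ∀ D : Bool → Measure X, (∀ b, IsProbabilityMeasure (D b)) →
    (∀ b, D b {x | f x = b} = 1) →
    ∀ A : Adversary X P.m, ∀ place : Fin P.m → Machine,
      (P.coinLaw.prod (callLaw lam D P.oracle))
        {ω | ¬ ∀ b, D b {x | P.output t ω.1 (localData place (A.sample ω.2)) x ≠ b}
              < ENNReal.ofReal ε} ≤ ENNReal.ofReal δ

end Protocol

/-- The communication complexity of learning `H` by `t`-round two-machine protocols (started by
either machine): the least number of bits exchanged by such a protocol, `⊤` if there is none. -/
noncomputable def commComplexity {X : Type*} [MeasurableSpace X] (H : Set (X → Bool)) (t : ℕ)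
    (ε δ lam : ℝ) : ℕ∞ :=
  ⨅ P : Protocol H, ⨅ _ : P.Learns t ε δ lam, (P.cost t : ℕ∞)

end RobustLearning

/-!
If all examples sit on the machine that does not announce the hypothesis, then for fixed public
coins the protocol can only produce the `2 ^ cost` hypotheses indexed by its possible transcripts.
Arrange about `d / 2` pairs of points of a shattered set, label the two points of each pair
oppositely, and let a random sign decide which of them is positive. For a fixed hypothesis, each
pair is classified no better than by a coin flip, so by Hoeffding's inequality the hypothesis is
accurate for an exponentially small fraction of the signs. Averaging over the coins, the `2 ^ cost`
hypotheses have to serve a fraction `1 - δ` of the signs, so `cost ≥ Ω(d) - log (1 / (1 - δ))`.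
The factors `(1 - ε) / (1 - lam)` and `1 / t ^ 2` are at most one, so this is more than the theorem
asks for.
-/

namespace RobustLearning

section Signs

variable {ι : Type*} [Fintype ι] [DecidableEq ι] {y : ι → Bool → ℝ}

lemma sum_exp_mul_sum_le (hodd : ∀ i b, y i (!b) = -y i b) (hy : ∀ i b, |y i b| ≤ 1) (u : ℝ) :
    ∑ s : ι → Bool, Real.exp (u * ∑ i, y i (s i)) ≤
      2 ^ Fintype.card ι * Real.exp (u ^ 2 / 2 * Fintype.card ι) := by
  have hpair (i : ι) : ∑ b, Real.exp (u * y i b) ≤ 2 * Real.exp (u ^ 2 / 2) := by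
    have hsq : (u * y i true) ^ 2 ≤ u ^ 2 := by
      rw [mul_pow]
      exact mul_le_of_le_one_right (sq_nonneg u) ((sq_le_one_iff_abs_le_one _).2 (hy i true))
    calc ∑ b, Real.exp (u * y i b) = 2 * Real.cosh (u * y i true) := by
          rw [Fintype.sum_bool, Real.cosh_eq, ← Bool.not_true, hodd i true, mul_neg]
          ring
      _ ≤ 2 * Real.exp ((u * y i true) ^ 2 / 2) := by
          gcongr
          exact Real.cosh_le_exp_half_sq _
      _ ≤ 2 * Real.exp (u ^ 2 / 2) := by gcongr
  calc ∑ s : ι → Bool, Real.exp (u * ∑ i, y i (s i))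
      = ∑ s : ι → Bool, ∏ i, Real.exp (u * y i (s i)) := by simp only [Finset.mul_sum, Real.exp_sum]
    _ = ∏ i, ∑ b, Real.exp (u * y i b) := by rw [Finset.prod_univ_sum, Fintype.piFinset_univ]
    _ ≤ ∏ _i : ι, 2 * Real.exp (u ^ 2 / 2) :=
        Finset.prod_le_prod (fun i _ => by positivity) fun i _ => hpair i
    _ = 2 ^ Fintype.card ι * Real.exp (u ^ 2 / 2 * Fintype.card ι) := by
        rw [Finset.prod_const, Finset.card_univ, mul_pow, ← Real.exp_nat_mul, mul_comm (u ^ 2 / 2)]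

lemma card_lt_sum_le_two_pow_mul_exp (hodd : ∀ i b, y i (!b) = -y i b)
    (hy : ∀ i b, |y i b| ≤ 1) {u : ℝ} (hu : 0 ≤ u) :
    (Finset.card {s : ι → Bool | u * Fintype.card ι < ∑ i, y i (s i)} : ℝ) ≤
      2 ^ Fintype.card ι * Real.exp (-(u ^ 2 / 2 * Fintype.card ι)) := by
  set n : ℝ := (Fintype.card ι : ℝ)
  set G : Finset (ι → Bool) := {s | u * n < ∑ i, y i (s i)}
  have hmarkov : G.card * Real.exp (u ^ 2 * n) ≤
      2 ^ Fintype.card ι * Real.exp (u ^ 2 / 2 * n) :=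
    calc G.card * Real.exp (u ^ 2 * n) = ∑ _s ∈ G, Real.exp (u ^ 2 * n) := by
          rw [Finset.sum_const, nsmul_eq_mul]
      _ ≤ ∑ s ∈ G, Real.exp (u * ∑ i, y i (s i)) := by
          refine Finset.sum_le_sum fun s hs => Real.exp_le_exp.2 ?_
          rw [sq, mul_assoc]
          exact mul_le_mul_of_nonneg_left (Finset.mem_filter.1 hs).2.le hu
      _ ≤ ∑ s : ι → Bool, Real.exp (u * ∑ i, y i (s i)) :=
          Finset.sum_le_univ_sum_of_nonneg fun _ => by positivity
      _ ≤ 2 ^ Fintype.card ι * Real.exp (u ^ 2 / 2 * n) := sum_exp_mul_sum_le hodd hy u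
  refine le_of_mul_le_mul_right (hmarkov.trans_eq ?_) (Real.exp_pos (u ^ 2 * n))
  rw [mul_assoc, ← Real.exp_add]
  ring_nf

lemma card_lt_sum_le_two_pow_mul_half (hodd : ∀ i b, y i (!b) = -y i b) {v : ℝ} (hv : 0 ≤ v) :
    (Finset.card {s : ι → Bool | v < ∑ i, y i (s i)} : ℝ) ≤ 2 ^ Fintype.card ι * (1 / 2) := by
  set G : Finset (ι → Bool) := {s | v < ∑ i, y i (s i)}
  let flip (s : ι → Bool) : ι → Bool := fun i => !s i
  have hflip : Function.Involutive flip := fun s => funext fun i => Bool.not_not (s i)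
  have hdisj : Disjoint G (G.image flip) := by
    rw [Finset.disjoint_right, Finset.forall_mem_image]
    intro s hs hs'
    have h₁ : v < ∑ i, y i (s i) := (Finset.mem_filter.1 hs).2
    have h₂ : v < ∑ i, y i (!s i) := (Finset.mem_filter.1 hs').2
    simp only [hodd, Finset.sum_neg_distrib] at h₂
    linarith
  have hcard : G.card + G.card ≤ 2 ^ Fintype.card ι := by
    have := Finset.card_le_univ (G ∪ G.image flip)
    rwa [Finset.card_union_of_disjoint hdisj, Finset.card_image_of_injective _ hflip.injective,
      Fintype.card_fun, Fintype.card_bool] at this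
  have : (G.card : ℝ) + G.card ≤ 2 ^ Fintype.card ι := by exact_mod_cast hcard
  linarith

end Signs

lemma exists_card_mem_le_sum_measure {Ω ι : Type*} [MeasurableSpace Ω] [Fintype ι]
    (μ : Measure Ω) [IsProbabilityMeasure μ] (U : ι → Set Ω) [∀ ω, DecidablePred (ω ∈ U ·)] :
    ∃ ω, (Finset.card {i | ω ∈ U i} : ℝ≥0∞) ≤ ∑ i, μ (U i) := by
  have hmeas (i : ι) : Measurable ((toMeasurable μ (U i)).indicator (1 : Ω → ℝ≥0∞)) :=
    measurable_one.indicator (measurableSet_toMeasurable μ (U i))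
  obtain ⟨ω, hω⟩ := exists_le_lintegral (μ := μ)
    (Finset.measurable_sum Finset.univ fun i _ => hmeas i).aemeasurable
  refine ⟨ω, ?_⟩
  calc (Finset.card {i | ω ∈ U i} : ℝ≥0∞) = ∑ i, (U i).indicator 1 ω := by
        simp [Set.indicator_apply]
    _ ≤ ∑ i, (toMeasurable μ (U i)).indicator 1 ω := by
        gcongr with i
        exact subset_toMeasurable μ (U i)
    _ ≤ ∑ i, μ (U i) := by
        simpa [lintegral_finsetSum _ fun i _ => hmeas i] using hω

section Empirical

variable {X ι : Type*} [MeasurableSpace X] [Fintype ι] [Nonempty ι]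

/-- The empirical measure of the finite family of points `p`, counted with multiplicity. -/
noncomputable def empiricalMeasure (p : ι → X) : Measure X :=
  ((PMF.uniformOfFintype ι).map p).toMeasure

instance (p : ι → X) : IsProbabilityMeasure (empiricalMeasure p) :=
  PMF.toMeasure.isProbabilityMeasure _

-- Equality can fail: if `A` is not measurable, its outer measure may count points outside `A`.
lemma card_div_card_le_empiricalMeasure (p : ι → X) (A : Set X) [DecidablePred (p · ∈ A)] :
    (Finset.card {i | p i ∈ A} : ℝ≥0∞) / Fintype.card ι ≤ empiricalMeasure p A := by
  classical
  refine le_trans (le_of_eq ?_) (PMF.toOuterMeasure_apply_le_toMeasure_apply _ A)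
  rw [PMF.toOuterMeasure_map_apply, PMF.toOuterMeasure_uniformOfFintype_apply,
    ← Fintype.card_subtype]
  congr!

lemma empiricalMeasure_eq_one_of_forall_mem {p : ι → X} {A : Set X} (hA : ∀ i, p i ∈ A) :
    empiricalMeasure p A = 1 := by
  classical
  refine le_antisymm prob_le_one ?_
  have h := card_div_card_le_empiricalMeasure p A
  rwa [Finset.filter_true_of_mem fun i _ => hA i, Finset.card_univ,
    ENNReal.div_self (by simp) (by simp)] at h

lemma card_mem_lt_of_empiricalMeasure_lt {p : ι → X} {A : Set X} [DecidablePred (p · ∈ A)] {ε : ℝ}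
    (h : empiricalMeasure p A < ENNReal.ofReal ε) :
    (Finset.card {i | p i ∈ A} : ℝ) < ε * Fintype.card ι := by
  have hε : 0 < ε := ENNReal.ofReal_pos.1 (pos_of_gt h)
  have hlt := (card_div_card_le_empiricalMeasure p A).trans_lt h
  rw [ENNReal.div_lt_iff (by simp) (by simp), ← ENNReal.ofReal_natCast, ← ENNReal.ofReal_natCast,
    ← ENNReal.ofReal_mul hε.le] at hlt
  exact (ENNReal.ofReal_lt_ofReal_iff_of_nonneg (Nat.cast_nonneg _)).1 hlt

end Empirical

/-- The hypothesis `h` has error less than `ε` on both the positive examples `D true` and the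
negative examples `D false`; this is the success event of `Protocol.Learns`. -/
def Accurate {X : Type*} [MeasurableSpace X] (D : Bool → Measure X) (ε : ℝ) (h : X → Bool) : Prop :=
  ∀ b, D b {x | h x ≠ b} < ENNReal.ofReal ε

/-- The target distributions on the pairs `a (i, false)`, `a (i, true)` with signs `s`: the uniform
distribution on the points with label `b`, where `a (i, β)` has the label `xor β (s i)`. -/
noncomputable def pairLaw {X ι : Type*} [MeasurableSpace X] [Fintype ι] [Nonempty ι]
    (a : ι × Bool → X) (s : ι → Bool) (b : Bool) : Measure X :=
  empiricalMeasure fun i => a (i, xor b (s i))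

/-- The advantage over guessing of the hypothesis `h` on the pair `i` with sign `σ`: one minus the
number of points of the pair that `h` mislabels. -/
def advantage {X ι : Type*} (a : ι × Bool → X) (h : X → Bool) (i : ι) (σ : Bool) : ℝ :=
  1 - ∑ b : Bool, if h (a (i, xor b σ)) ≠ b then 1 else 0

lemma advantage_not {X ι : Type*} (a : ι × Bool → X) (h : X → Bool) (i : ι) (σ : Bool) :
    advantage a h i (!σ) = -advantage a h i σ := by
  cases σ <;> cases h₀ : h (a (i, false)) <;> cases h₁ : h (a (i, true)) <;>
    norm_num [advantage, h₀, h₁]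

lemma abs_advantage_le_one {X ι : Type*} (a : ι × Bool → X) (h : X → Bool) (i : ι) (σ : Bool) :
    |advantage a h i σ| ≤ 1 := by
  cases σ <;> cases h₀ : h (a (i, false)) <;> cases h₁ : h (a (i, true)) <;>
    norm_num [advantage, h₀, h₁]

section PairLaw

variable {X ι : Type*} [MeasurableSpace X] [Fintype ι] [Nonempty ι]

instance (a : ι × Bool → X) (s : ι → Bool) (b : Bool) : IsProbabilityMeasure (pairLaw a s b) :=
  inferInstanceAs (IsProbabilityMeasure (empiricalMeasure _))

lemma pairLaw_setOf_eq_one {a : ι × Bool → X} {s : ι → Bool} {f : X → Bool}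
    (hf : ∀ i β, f (a (i, β)) = xor β (s i)) (b : Bool) : pairLaw a s b {x | f x = b} = 1 :=
  empiricalMeasure_eq_one_of_forall_mem fun i => by simp [hf]

lemma Accurate.lt_sum_advantage {a : ι × Bool → X} {s : ι → Bool} {ε : ℝ} {h : X → Bool}
    (hacc : Accurate (pairLaw a s) ε h) :
    (1 - 2 * ε) * Fintype.card ι < ∑ i, advantage a h i (s i) := by
  have herr (b : Bool) :
      ∑ i, (if h (a (i, xor b (s i))) ≠ b then 1 else 0 : ℝ) < ε * Fintype.card ι := by
    rw [Finset.sum_boole]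
    exact card_mem_lt_of_empiricalMeasure_lt (hacc b)
  calc (1 - 2 * ε) * Fintype.card ι = Fintype.card ι - ∑ _b : Bool, ε * Fintype.card ι := by
        rw [Fintype.sum_bool]
        ring
    _ < Fintype.card ι - ∑ b : Bool, ∑ i, if h (a (i, xor b (s i))) ≠ b then 1 else 0 :=
        sub_lt_sub_left (Finset.sum_lt_sum_of_nonempty Finset.univ_nonempty fun b _ => herr b) _
    _ = ∑ i, advantage a h i (s i) := by
        simp only [advantage, Finset.sum_sub_distrib]
        rw [Finset.sum_comm, Finset.sum_const, nsmul_one, Finset.card_univ]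

open scoped Classical in
lemma card_accurate_pairLaw_le (a : ι × Bool → X) (h : X → Bool) {ε : ℝ} (hε : ε ≤ 1 / 2) :
    (Finset.card {s : ι → Bool | Accurate (pairLaw a s) ε h} : ℝ) ≤ 2 ^ Fintype.card ι *
      min (1 / 2) (Real.exp (-((1 - 2 * ε) ^ 2 / 2 * Fintype.card ι))) := by
  have hu : 0 ≤ 1 - 2 * ε := by linarith
  have hsub : ({s | Accurate (pairLaw a s) ε h} : Finset (ι → Bool)) ⊆
      ({s | (1 - 2 * ε) * Fintype.card ι < ∑ i, advantage a h i (s i)} : Finset (ι → Bool)) :=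
    Finset.monotone_filter_right _ fun _ _ => Accurate.lt_sum_advantage
  rw [mul_min_of_nonneg _ _ (by positivity)]
  refine (Nat.cast_le.2 (Finset.card_le_card hsub)).trans (le_min ?_ ?_)
  · exact card_lt_sum_le_two_pow_mul_half (advantage_not a h) (by positivity)
  · exact card_lt_sum_le_two_pow_mul_exp (advantage_not a h) (abs_advantage_le_one a h) hu

end PairLaw

lemma Shatters.exists_forall_apply_eq {X κ : Type*} [Fintype κ] {H : Set (X → Bool)} {S : Finset X}
    (hS : Shatters H S) (hcard : Fintype.card κ ≤ S.card) :
    ∃ a : κ → X, ∀ g : κ → Bool, ∃ f ∈ H, ∀ q, f (a q) = g q := by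
  obtain ⟨e⟩ := Function.Embedding.nonempty_of_card_le (hcard.trans_eq (Fintype.card_coe S).symm)
  have hinj : Function.Injective fun q => (e q : X) := Subtype.val_injective.comp e.injective
  refine ⟨fun q => e q, fun g => ?_⟩
  obtain ⟨f, hf, hfg⟩ := hS (Function.extend (fun q => (e q : X)) g fun _ => false)
  exact ⟨f, hf, fun q => (hfg (e q) (e q).2).trans (hinj.extend_apply g _ q)⟩

lemma localData_other_eq_none {X : Type*} {m : ℕ} (M : Machine) (x : Fin m → X) :
    localData (fun _ => M.other) x M = fun _ => none := by
  funext i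
  cases M <;> rfl

namespace Protocol

variable {X : Type*} {H : Set (X → Bool)}

lemma length_transcript (P : Protocol H) (c : P.Coins) (v : Machine → Fin P.m → Option X)
    (t : ℕ) : (P.transcript c v t).length = P.cost t := by
  induction t with
  | zero => rfl
  | succ t ih =>
    rw [transcript, List.length_append, ih, List.length_ofFn, cost, cost, Finset.sum_range_succ]

/-- The hypothesis announced by a machine that holds no examples and has seen the bits `r`. -/
def blindOutput (P : Protocol H) (c : P.Coins) (r : List Bool) : X → Bool :=
  P.announce c (fun _ => none) r

lemma exists_output_eq_blindOutput (P : Protocol H) (t : ℕ) (c : P.Coins) (x : Fin P.m → X) :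
    ∃ r : List.Vector Bool (P.cost t),
      P.output t c (localData (fun _ => (P.speaker t).other) x) = P.blindOutput c r.toList := by
  refine ⟨⟨_, P.length_transcript c (localData (fun _ => (P.speaker t).other) x) t⟩, ?_⟩
  rw [output, blindOutput, localData_other_eq_none]
  rfl

end Protocol

/-- The adversary that answers every corrupted call with the clean example. -/
def Adversary.honest (X : Type*) [MeasurableSpace X] (m : ℕ) : Adversary X m where
  choose i z := (z ⟨i, le_refl i⟩).2
  measurable_choose _ := (measurable_pi_apply _).snd

lemma isProbabilityMeasure_flagLaw {lam : ℝ} (h₀ : 0 ≤ lam) (h₁ : lam ≤ 1) :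
    IsProbabilityMeasure (flagLaw lam) :=
  ⟨by simp [flagLaw, ← ENNReal.ofReal_add (sub_nonneg.2 h₁) h₀]⟩

/-- The coefficient `γ` of the dimension in the bound `γ * (d - 1) - log (1 / (1 - δ))` on the cost
of learning to error `ε`. -/
noncomputable def dimRate (ε : ℝ) : ℝ := (1 - 2 * ε) ^ 2 / 4

/-- A dimension from which on learning to error `ε` with failure probability `δ` costs at least one
bit. -/
noncomputable def thresholdDim (ε δ : ℝ) : ℕ :=
  if δ < 1 / 2 then 2 else ⌊-Real.log (1 - δ) / dimRate ε⌋₊ + 2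

lemma dimRate_nonneg (ε : ℝ) : 0 ≤ dimRate ε := by
  unfold dimRate
  positivity

lemma dimRate_pos {ε : ℝ} (hε : ε < 1 / 2) : 0 < dimRate ε := by
  have : 0 < 1 - 2 * ε := by linarith
  unfold dimRate
  positivity

lemma two_le_thresholdDim (ε δ : ℝ) : 2 ≤ thresholdDim ε δ := by
  unfold thresholdDim
  split_ifs <;> omega

namespace Protocol.Learns

variable {X : Type*} [MeasurableSpace X] {H : Set (X → Bool)} {P : Protocol H} {t : ℕ}
  {ε δ lam : ℝ}

lemma coinLaw_forall_not_accurate_le (hP : P.Learns t ε δ lam) (h₀ : 0 ≤ lam) (h₁ : lam ≤ 1)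
    {f : X → Bool} (hf : f ∈ H) (D : Bool → Measure X) [∀ b, IsProbabilityMeasure (D b)]
    (hD : ∀ b, D b {x | f x = b} = 1) :
    P.coinLaw {c | ∀ r : List.Vector Bool (P.cost t), ¬ Accurate D ε (P.blindOutput c r.toList)} ≤
      ENNReal.ofReal δ := by
  have := isProbabilityMeasure_flagLaw h₀ h₁
  have : IsProbabilityMeasure (callLaw lam D P.oracle) := by
    unfold callLaw
    infer_instance
  set U := {c | ∀ r : List.Vector Bool (P.cost t), ¬ Accurate D ε (P.blindOutput c r.toList)}
  calc P.coinLaw U = (P.coinLaw.prod (callLaw lam D P.oracle)) (U ×ˢ Set.univ) := by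
        rw [Measure.prod_prod, measure_univ, mul_one]
    _ ≤ _ := measure_mono ?_
    _ ≤ ENNReal.ofReal δ := hP f hf D inferInstance hD (Adversary.honest X P.m)
        fun _ => (P.speaker t).other
  rintro ⟨c, z⟩ ⟨hc, -⟩
  obtain ⟨r, hr⟩ := P.exists_output_eq_blindOutput t c ((Adversary.honest X P.m).sample z)
  simp only [Set.mem_ofPred_eq, hr]
  exact hc r

lemma one_sub_le_two_pow_cost_mul (hP : P.Learns t ε δ lam) (h₀ : 0 ≤ lam) (h₁ : lam ≤ 1)
    (hδ : 0 ≤ δ) (hε : ε ≤ 1 / 2) {ι : Type*} [Fintype ι] [Nonempty ι] {a : ι × Bool → X}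
    (ha : ∀ g : ι × Bool → Bool, ∃ f ∈ H, ∀ q, f (a q) = g q) :
    1 - δ ≤ 2 ^ P.cost t *
      min (1 / 2) (Real.exp (-((1 - 2 * ε) ^ 2 / 2 * Fintype.card ι))) := by
  classical
  set n := Fintype.card ι
  set B := min (1 / 2) (Real.exp (-((1 - 2 * ε) ^ 2 / 2 * n)))
  let Good (c : P.Coins) (r : List.Vector Bool (P.cost t)) : Finset (ι → Bool) :=
    {s | Accurate (pairLaw a s) ε (P.blindOutput c r.toList)}
  let U (s : ι → Bool) : Set P.Coins := {c | ∀ r, s ∉ Good c r}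
  have hU (s : ι → Bool) : P.coinLaw (U s) ≤ ENNReal.ofReal δ := by
    obtain ⟨f, hf, hfa⟩ := ha fun q => xor q.2 (s q.1)
    simpa [U, Good] using hP.coinLaw_forall_not_accurate_le h₀ h₁ hf (pairLaw a s)
      (pairLaw_setOf_eq_one fun i β => hfa (i, β))
  obtain ⟨c, hc⟩ := exists_card_mem_le_sum_measure P.coinLaw U
  have hbad : (Finset.card {s | c ∈ U s} : ℝ) ≤ 2 ^ n * δ := by
    have h := hc.trans (Finset.sum_le_card_nsmul Finset.univ _ _ fun s _ => hU s)
    rwa [← ENNReal.ofReal_natCast, ← ENNReal.ofReal_nsmul,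
      ENNReal.ofReal_le_ofReal_iff (by positivity), nsmul_eq_mul, Finset.card_univ,
      Fintype.card_fun, Fintype.card_bool, Nat.cast_pow, Nat.cast_ofNat] at h
  have hgood : (Finset.card {s | c ∉ U s} : ℝ) ≤ 2 ^ P.cost t * (2 ^ n * B) := by
    have hsub : ({s | c ∉ U s} : Finset (ι → Bool)) ⊆ Finset.univ.biUnion (Good c) :=
      fun s hs => by simpa [U] using hs
    calc (Finset.card {s | c ∉ U s} : ℝ) ≤ ∑ r, ((Good c r).card : ℝ) := by
          exact_mod_cast (Finset.card_le_card hsub).trans Finset.card_biUnion_le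
      _ ≤ ∑ _r : List.Vector Bool (P.cost t), 2 ^ n * B :=
          Finset.sum_le_sum fun r _ => card_accurate_pairLaw_le a _ hε
      _ = 2 ^ P.cost t * (2 ^ n * B) := by simp
  have htotal : (Finset.card {s | c ∈ U s} : ℝ) + Finset.card {s | c ∉ U s} = 2 ^ n := by
    exact_mod_cast (Finset.card_filter_add_card_filter_not _).trans (by simp [n])
  refine le_of_mul_le_mul_left ?_ (by positivity : (0 : ℝ) < 2 ^ n)
  linarith

lemma mono_error (hP : P.Learns t ε δ lam) {ε' : ℝ} (hε : ε ≤ ε') : P.Learns t ε' δ lam := by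
  intro f hf D hD hsupp A place
  refine (measure_mono fun ω hfail => ?_).trans (hP f hf D hD hsupp A place)
  exact mt (fun hacc b => (hacc b).trans_le (ENNReal.ofReal_le_ofReal hε)) hfail

lemma one_sub_le_two_pow_cost_mul_of_shatters (hP : P.Learns t ε δ lam) (h₀ : 0 ≤ lam)
    (h₁ : lam ≤ 1) (hδ : 0 ≤ δ) (hε : ε ≤ 1 / 2) {S : Finset X} (hS : Shatters H S) {k : ℕ}
    (hk : k ≠ 0) (hkS : 2 * k ≤ S.card) :
    1 - δ ≤ 2 ^ P.cost t * min (1 / 2) (Real.exp (-((1 - 2 * ε) ^ 2 / 2 * k))) := by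
  have : NeZero k := ⟨hk⟩
  obtain ⟨a, ha⟩ := hS.exists_forall_apply_eq (κ := Fin k × Bool) (by simpa [mul_comm] using hkS)
  simpa using hP.one_sub_le_two_pow_cost_mul h₀ h₁ hδ hε ha

lemma one_le_cost_of_two_le_card (hP : P.Learns t ε δ lam) (h₀ : 0 ≤ lam) (h₁ : lam ≤ 1)
    (hδ : 0 ≤ δ) (hδ' : δ < 1 / 2) (hε : ε ≤ 1 / 2) {S : Finset X} (hS : Shatters H S)
    (hcard : 2 ≤ S.card) : 1 ≤ P.cost t := by
  by_contra! hlt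
  have h := hP.one_sub_le_two_pow_cost_mul_of_shatters h₀ h₁ hδ hε hS one_ne_zero hcard
  rw [Nat.lt_one_iff.1 hlt, pow_zero, one_mul] at h
  linarith [h.trans (min_le_left _ _)]

lemma mul_card_sub_one_add_log_le_cost (hP : P.Learns t ε δ lam) (h₀ : 0 ≤ lam) (h₁ : lam ≤ 1)
    (hδ : 0 ≤ δ) (hδ' : δ < 1) (hε : ε ≤ 1 / 2) {S : Finset X} (hS : Shatters H S) :
    dimRate ε * (S.card - 1) + Real.log (1 - δ) ≤ P.cost t := by
  obtain ⟨k, hk⟩ : ∃ k, k = S.card / 2 := ⟨_, rfl⟩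
  have hcard : (S.card : ℝ) - 1 ≤ 2 * k := by
    rw [sub_le_iff_le_add]
    exact_mod_cast (by omega : S.card ≤ 2 * k + 1)
  have hpairs : (1 - 2 * ε) ^ 2 / 2 * k + Real.log (1 - δ) ≤ P.cost t := by
    obtain rfl | hk₀ := eq_or_ne k 0
    · have := Real.log_nonpos (by linarith : 0 ≤ 1 - δ) (by linarith)
      simpa using this.trans (Nat.cast_nonneg (P.cost t))
    have h := hP.one_sub_le_two_pow_cost_mul_of_shatters h₀ h₁ hδ hε hS hk₀ (by omega)
    have hexp : 1 - δ ≤ 2 ^ P.cost t * Real.exp (-((1 - 2 * ε) ^ 2 / 2 * k)) :=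
      h.trans (mul_le_mul_of_nonneg_left (min_le_right _ _) (by positivity))
    have hlog := Real.log_le_log (by linarith) hexp
    rw [Real.log_mul (by positivity) (by positivity), Real.log_exp, Real.log_pow] at hlog
    have hbits : (P.cost t : ℝ) * Real.log 2 ≤ P.cost t :=
      mul_le_of_le_one_right (Nat.cast_nonneg _) (by linarith [Real.log_two_lt_d9])
    linarith
  calc dimRate ε * (S.card - 1) + Real.log (1 - δ)
      ≤ dimRate ε * (2 * k) + Real.log (1 - δ) := by
        gcongr
        exact dimRate_nonneg ε
    _ = (1 - 2 * ε) ^ 2 / 2 * k + Real.log (1 - δ) := by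
        unfold dimRate
        ring
    _ ≤ P.cost t := hpairs

lemma one_le_cost_of_thresholdDim_le (hP : P.Learns t ε δ lam) (h₀ : 0 ≤ lam) (h₁ : lam ≤ 1)
    (hδ : 0 ≤ δ) (hδ' : δ < 1) (hε : ε < 1 / 2) {S : Finset X} (hS : Shatters H S)
    (hcard : thresholdDim ε δ ≤ S.card) : 1 ≤ P.cost t := by
  by_cases hhalf : δ < 1 / 2
  · exact hP.one_le_cost_of_two_le_card h₀ h₁ hδ hhalf hε.le hS
      ((two_le_thresholdDim ε δ).trans hcard)
  have hfloor : ⌊-Real.log (1 - δ) / dimRate ε⌋₊ + 2 ≤ S.card := by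
    rwa [thresholdDim, if_neg hhalf] at hcard
  have hlog : -Real.log (1 - δ) < dimRate ε * (S.card - 1) := by
    rw [← div_lt_iff₀' (dimRate_pos hε)]
    have : (⌊-Real.log (1 - δ) / dimRate ε⌋₊ : ℝ) + 2 ≤ S.card := by exact_mod_cast hfloor
    linarith [Nat.lt_floor_add_one (-Real.log (1 - δ) / dimRate ε)]
  have hcost := hP.mul_card_sub_one_add_log_le_cost h₀ h₁ hδ hδ' hε.le hS
  exact Nat.cast_pos.1 (by linarith : (0 : ℝ) < P.cost t)

lemma div_mul_card_le_cost (hP : P.Learns t ε δ lam) (h₀ : 0 ≤ lam) (h₁ : lam ≤ 1)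
    (hδ : 0 ≤ δ) (hδ' : δ < 1) (hε : ε < 1 / 2) (hcost : 1 ≤ P.cost t) {S : Finset X}
    (hS : Shatters H S) :
    dimRate ε / (dimRate ε + 1 - Real.log (1 - δ)) * S.card ≤ P.cost t := by
  have hγ := dimRate_pos hε
  have hlog : Real.log (1 - δ) ≤ 0 := Real.log_nonpos (by linarith) (by linarith)
  have hlin := hP.mul_card_sub_one_add_log_le_cost h₀ h₁ hδ hδ' hε.le hS
  have habsorb : dimRate ε - Real.log (1 - δ) ≤ (dimRate ε - Real.log (1 - δ)) * P.cost t :=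
    le_mul_of_one_le_right (by linarith) (by exact_mod_cast hcost)
  rw [div_mul_eq_mul_div, div_le_iff₀ (by linarith)]
  linarith

end Protocol.Learns

lemma exists_shatters_of_le_vcDim {X : Type*} {H : Set (X → Bool)} {n : ℕ} (hn : n ≠ 0)
    (h : (n : ℕ∞) ≤ vcDim H) : ∃ S, Shatters H S ∧ n ≤ S.card := by
  have hlt : ((n - 1 : ℕ) : ℕ∞) < vcDim H :=
    lt_of_lt_of_le (by exact_mod_cast Nat.sub_one_lt hn) h
  simp only [vcDim, lt_iSup_iff, Nat.cast_lt, exists_prop] at hlt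
  obtain ⟨S, hS, hcard⟩ := hlt
  exact ⟨S, hS, by omega⟩

lemma ofReal_mul_vcDim_le {X : Type*} {H : Set (X → Bool)} {c : ℝ} {N : ℕ} (hc : 0 ≤ c)
    (h : ∀ S, Shatters H S → c * S.card ≤ N) :
    ENNReal.ofReal c * (vcDim H : ℝ≥0∞) ≤ N := by
  simp only [vcDim, ENat.toENNReal_iSup, ENNReal.mul_iSup, iSup_le_iff, ENat.toENNReal_coe]
  intro S hS
  rw [← ENNReal.ofReal_natCast, ← ENNReal.ofReal_natCast, ← ENNReal.ofReal_mul hc]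
  exact ENNReal.ofReal_le_ofReal (h S hS)

lemma mul_div_div_sq_le_self {c ε lam : ℝ} (hc : 0 ≤ c) (hlam : lam ≤ ε) (hlam' : lam ≤ 1) {t : ℕ}
    (ht : 1 ≤ t) : c * ((1 - ε) / (1 - lam)) / (t : ℝ) ^ 2 ≤ c := by
  have hratio : (1 - ε) / (1 - lam) ≤ 1 := div_le_one_of_le₀ (by linarith) (by linarith)
  have ht₁ : (1 : ℝ) ≤ (t : ℝ) ^ 2 := one_le_pow₀ (by exact_mod_cast ht)
  rw [div_le_iff₀ (by positivity)]
  exact (mul_le_of_le_one_right hc hratio).trans (le_mul_of_one_le_right hc ht₁)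

end RobustLearning

open RobustLearning in
theorem theorem2_general (ε₀ δ : ℝ) (hε₀ : ε₀ < 1 / 2) (hδ : 0 ≤ δ) (hδ' : δ < 1) :
    ∃ c : ℝ, 0 < c ∧ ∃ d₀ : ℕ, (δ < 1 / 2 → d₀ ≤ 2) ∧
      ∀ (X : Type*) [MeasurableSpace X] (H : Set (X → Bool)),
        (d₀ : ℕ∞) ≤ vcDim H →
        ∀ ε lam : ℝ, 0 ≤ lam → lam ≤ 1 → ε ≤ ε₀ → ∀ t : ℕ,
          ENNReal.ofReal c * (vcDim H : ENNReal)
            ≤ (commComplexity H t ε δ lam : ENNReal) := by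
  have hγ := dimRate_pos hε₀
  have hlog : Real.log (1 - δ) ≤ 0 := Real.log_nonpos (by linarith) (by linarith)
  have hc : 0 < dimRate ε₀ / (dimRate ε₀ + 1 - Real.log (1 - δ)) := div_pos hγ (by linarith)
  refine ⟨_, hc, thresholdDim ε₀ δ, fun h => (if_pos h).le, ?_⟩
  intro X _ H hd ε lam h₀ h₁ hε t
  have hd₀ : thresholdDim ε₀ δ ≠ 0 := (zero_lt_two.trans_le (two_le_thresholdDim ε₀ δ)).ne'
  obtain ⟨S, hS, hcard⟩ := exists_shatters_of_le_vcDim hd₀ hd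
  simp only [commComplexity, ENat.toENNReal_iInf, le_iInf_iff, ENat.toENNReal_coe]
  intro P hP
  have hP₀ := hP.mono_error hε
  have hcost := hP₀.one_le_cost_of_thresholdDim_le h₀ h₁ hδ hδ' hε₀ hS hcard
  exact ofReal_mul_vcDim_le hc.le fun T hT =>
    hP₀.div_mul_card_le_cost h₀ h₁ hδ hδ' hε₀ hcost hT

theorem theorem2 (ε₀ δ : ℝ) (hε₀ : ε₀ < 1 / 2) (hδ : 0 < δ) (hδ' : δ < 1) :
    ∃ c : ℝ, 0 < c ∧ ∃ d₀ : ℕ, (δ < 1 / 2 → d₀ ≤ 2) ∧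
      ∀ (X : Type*) [MeasurableSpace X] (H : Set (X → Bool)),
        (∀ h ∈ H, Measurable h) → (d₀ : ℕ∞) ≤ RobustLearning.vcDim H →
        ∀ ε lam : ℝ, 0 ≤ lam → lam < ε → ε ≤ ε₀ → ∀ t : ℕ, 1 ≤ t →
          ENNReal.ofReal (c * ((1 - ε) / (1 - lam)) / (t : ℝ) ^ 2) *
              (RobustLearning.vcDim H : ENNReal)
            ≤ (RobustLearning.commComplexity H t ε δ lam : ENNReal) := by
  obtain ⟨c, hc, d₀, hd₀, h⟩ := theorem2_general ε₀ δ hε₀ hδ.le hδ'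
  exact ⟨c, hc, d₀, hd₀, fun X _ H _ hd ε lam h₀ hlam hε t ht => le_trans
    (mul_le_mul_left (ENNReal.ofReal_le_ofReal
      (RobustLearning.mul_div_div_sq_le_self hc.le hlam.le (by linarith) ht)) _)
    (h X H hd ε lam h₀ (by linarith) hε t)⟩
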